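/- An election with $m$ candidates and $n$ electors is an $n$-tuple $P=(V_1,\dots,V_n)$ of strict total orders (preferences) on a set $C$ of $m$ candidates, here $C=\{1,\dots,m\}$; electors are labelled. It is *group-separable* if every subset $C'\subseteq C$ with at least two elements can be partitioned into two nonempty blocks $A,B$ such that each elector ranks all candidates of $A$ above all candidates of $B$ or vice versa. It *contains* a configuration $(T_1,T_2)$, where $T_1,T_2$ are total orders on $\{a,b,c,d\}$, if there are an injection $f:\{1,2\}\to\{1,\dots,n\}$ and an injection $g:\{a,b,c,d\}\to C$ such that $x>_{T_i}y$ implies $g(x)>_{V_{f(i)}}g(y)$ for $i=1,2$ and all $x,y$; otherwise it *avoids* it. An election is *enriched group-separable* if it is group-separable and avoids both configurations $(abcd,badc)$ and $(acbd,bdac)$, where orders are written by listing candidates from most to least preferred. Let $f(m,n)$ be the number of enriched group-separable elections with $m$ candidates and $n$ electors, and let $f_r(m,n)$ be the number of those in which the preference of one given elector is fixed to be one given total order. Let $m\ge 0$, $n\ge 2$ and $\varphi=\sqrt{2^{n-1}(2^{n-1}-1)}$. Then, whichever elector and whichever total order are chosen, $$f_r(m,n)=\frac{\varphi+(1-2^{n-1})}{2\varphi}\left(2^{n-1}+\varphi\right)^m+\frac{\varphi-(1-2^{n-1})}{2\varphi}\left(2^{n-1}-\varphi\right)^m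 ,$$ and $$f(m,n)=m!\left(\frac{\varphi+(1-2^{n-1})}{2\varphi}\left(2^{n-1}+\varphi\right)^m+\frac{\varphi-(1-2^{n-1})}{2\varphi}\left(2^{n-1}-\varphi\right)^m\right).$$ -/

import Mathlib

/-- A preference on the candidate set `C`: a strict total order, where `V.above x y` means that
the voter ranks `x` above `y`. -/
@[ext]
structure Preference (C : Type*) where
  above : C → C → Prop
  strictTotal : IsStrictTotalOrder C above

/-- An election with candidate set `C` and electors `Fin n`: a tuple of `n` preferences. -/
abbrev Election (C : Type*) (n : ℕ) := Fin n → Preference C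

/-- The preference given by listing all candidates in decreasing order of preference. -/
def Preference.ofList {C : Type*} [DecidableEq C] (l : List C) (hl : ∀ x, x ∈ l) :
    Preference C where
  above x y := l.idxOf x < l.idxOf y
  strictTotal :=
    { trichotomous := fun x y h1 h2 =>
        (List.idxOf_inj (hl x)).1 (le_antisymm (not_lt.1 h2) (not_lt.1 h1))
      irrefl := fun _ => lt_irrefl _
      trans := fun _ _ _ => lt_trans }

namespace Election

/-- The election `P` contains the configuration `T`. -/
def Contains {C S : Type*} {n l : ℕ} (P : Election C n) (T : Election S l) : Prop :=
  ∃ f : Fin l → Fin n, ∃ g : S → C, Function.Injective f ∧ Function.Injective g ∧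
    ∀ (i : Fin l) (x y : S), (T i).above x y → (P (f i)).above (g x) (g y)

/-- Group-separability: each set of at least two candidates splits into two nonempty blocks
`A`, `B` such that every elector ranks all of `A` above all of `B` or vice versa. -/
def GroupSeparable {C : Type*} {n : ℕ} (P : Election C n) : Prop :=
  ∀ C' : Set C, C'.Nontrivial →
    ∃ A B : Set C, A.Nonempty ∧ B.Nonempty ∧ Disjoint A B ∧ A ∪ B = C' ∧
      ∀ i : Fin n, (∀ x ∈ A, ∀ y ∈ B, (P i).above x y) ∨ (∀ x ∈ A, ∀ y ∈ B, (P i).above y x)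

/-- The `(4,2)`-configuration `(abcd, badc)`, with `a, b, c, d` encoded as `0, 1, 2, 3`. -/
def configABCD_BADC : Election (Fin 4) 2 :=
  ![Preference.ofList [0, 1, 2, 3] (by decide), Preference.ofList [1, 0, 3, 2] (by decide)]

/-- The `(4,2)`-configuration `(acbd, bdac)`, with `a, b, c, d` encoded as `0, 1, 2, 3`. -/
def configACBD_BDAC : Election (Fin 4) 2 :=
  ![Preference.ofList [0, 2, 1, 3] (by decide), Preference.ofList [1, 3, 0, 2] (by decide)]

/-- Enriched group-separable elections. -/
def EnrichedGroupSeparable {C : Type*} {n : ℕ} (P : Election C n) : Prop :=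
  P.GroupSeparable ∧ ¬ P.Contains configABCD_BADC ∧ ¬ P.Contains configACBD_BDAC

/-- `f(m,n)`: the number of enriched group-separable elections with `m` candidates and `n`
electors. -/
noncomputable def numEnriched (m n : ℕ) : ℕ :=
  Nat.card {P : Election (Fin m) n // P.EnrichedGroupSeparable}

/-- `f_r(m,n)`: the number of such elections in which the preference of elector `i` is fixed to
be `V`. -/
noncomputable def numEnrichedFixed (m n : ℕ) (i : Fin n) (V : Preference (Fin m)) : ℕ :=
  Nat.card {P : Election (Fin m) n // P.EnrichedGroupSeparable ∧ P i = V}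

end Election

/-! Fix the ballot V of elector i, with top t and bottom b. Call a candidate extremal if every
elector ranks it first or last. In an enriched group-separable election with at least two
candidates, t or b is extremal (`extremal_or_extremal`). Conversely, inserting an extremal candidate
into an enriched group-separable election keeps it so (`Extremal.enrichedGroupSeparable`), since
neither forbidden configuration has an extremal candidate. Let N = 2^(n-1). An extremal t (or b)
leaves a free choice of side to each of the other n-1 electors, giving N·F(m+1) elections on m+2
candidates. If both are extremal, they lie at opposite ends, so b alone determines the sides, giving
N·F(m). Inclusion-exclusion yields F(m+2) = 2N·F(m+1) - N·F(m) with F(0) = F(1) = 1, whatever V is.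
The closed form solves this recurrence, and summing over the m! ballots of one elector gives f(m,n).
-/

namespace Preference

/-! ### Preferences: removing and inserting a top or bottom candidate -/

variable {C D : Type*}

theorem irrefl (V : Preference C) (x : C) : ¬ V.above x x := V.strictTotal.irrefl x

theorem trans (V : Preference C) {x y z : C} (h₁ : V.above x y) (h₂ : V.above y z) :
    V.above x z := V.strictTotal.trans x y z h₁ h₂

theorem asymm (V : Preference C) {x y : C} (h : V.above x y) : ¬ V.above y x :=
  fun h' => V.irrefl x (V.trans h h')

theorem ne (V : Preference C) {x y : C} (h : V.above x y) : x ≠ y := by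
  rintro rfl
  exact V.irrefl x h

theorem not_above (V : Preference C) {x y : C} (hxy : x ≠ y) : ¬ V.above x y ↔ V.above y x :=
  ⟨fun h => by_contra fun h' => hxy (V.strictTotal.trichotomous x y h h'), V.asymm⟩

instance [Finite C] : Finite (Preference C) :=
  Finite.of_injective (fun V : Preference C => V.above) fun _ _ h => Preference.ext h

instance [Subsingleton C] : Subsingleton (Preference C) where
  allEq V W := by
    ext x y
    rw [Subsingleton.elim y x]
    exact iff_of_false (V.irrefl x) (W.irrefl x)

/-- The preference pulled back along an injection. -/
def comap (V : Preference C) (f : D → C) (hf : Function.Injective f) : Preference D where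
  above x y := V.above (f x) (f y)
  strictTotal :=
    { trichotomous := fun _ _ h₁ h₂ => hf (V.strictTotal.trichotomous _ _ h₁ h₂)
      irrefl := fun x => V.irrefl (f x)
      trans := fun _ _ _ => V.trans }

/-- The preference with the candidate `c` removed. -/
def remove (V : Preference C) (c : C) : Preference {x // x ≠ c} :=
  V.comap Subtype.val Subtype.val_injective

/-- The candidate `c` is ranked above all others. -/
def IsTop (V : Preference C) (c : C) : Prop := ∀ x, x ≠ c → V.above c x

/-- The candidate `c` is ranked below all others. -/
def IsBot (V : Preference C) (c : C) : Prop := ∀ x, x ≠ c → V.above x c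

theorem IsTop.not_isBot [Nontrivial C] {V : Preference C} {c : C} (h : V.IsTop c) :
    ¬ V.IsBot c := fun h' => by
  obtain ⟨x, hx⟩ := exists_ne c
  exact V.asymm (h x hx) (h' x hx)

theorem exists_isTop [Finite C] [Nonempty C] (V : Preference C) : ∃ c, V.IsTop c := by
  have := V.strictTotal
  obtain ⟨c, -, hc⟩ := (Finite.wellFounded_of_trans_of_irrefl V.above).has_min Set.univ
    Set.univ_nonempty
  exact ⟨c, fun x hx => (V.not_above hx).1 (hc x trivial)⟩

theorem exists_isBot [Finite C] [Nonempty C] (V : Preference C) : ∃ c, V.IsBot c := by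
  have := V.strictTotal
  obtain ⟨c, -, hc⟩ := (Finite.wellFounded_of_trans_of_irrefl (Function.swap V.above)).has_min
    Set.univ Set.univ_nonempty
  exact ⟨c, fun x hx => (V.not_above hx.symm).1 (hc x trivial)⟩

/-- The preference obtained by adding `c` at the top if `s` holds, and at the bottom otherwise. -/
def extend (c : C) (s : Prop) (V : Preference {x // x ≠ c}) : Preference C where
  above x y := (x = c ∧ y ≠ c ∧ s) ∨ (y = c ∧ x ≠ c ∧ ¬ s) ∨
    ∃ (hx : x ≠ c) (hy : y ≠ c), V.above ⟨x, hx⟩ ⟨y, hy⟩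
  strictTotal :=
    { trichotomous := fun x y h₁ h₂ => by
        by_contra hxy
        by_cases hx : x = c
        · by_cases hs : s <;> grind
        · by_cases hy : y = c
          · by_cases hs : s <;> grind
          · have := V.not_above (x := ⟨x, hx⟩) (y := ⟨y, hy⟩) (by simpa using hxy)
            grind
      irrefl := fun x => by
        rintro (h | h | ⟨hx, hy, h⟩)
        · exact h.2.1 h.1
        · exact h.2.1 h.1
        · exact V.irrefl _ h
      trans := fun x y z => by
        rintro (h | h | ⟨hx, hy, h⟩) (h' | h' | ⟨hx', hy', h'⟩)
        · exact absurd h'.1 h.2.1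
        · exact absurd h.2.2 h'.2.2
        · exact Or.inl ⟨h.1, hy', h.2.2⟩
        · exact absurd h'.2.2 h.2.2
        · exact absurd h.1 h'.2.1
        · exact absurd h.1 hx'
        · exact absurd h'.1 hy
        · exact Or.inr (Or.inl ⟨h'.1, hx, h'.2.2⟩)
        · exact Or.inr (Or.inr ⟨hx, hy', V.trans h h'⟩) }

theorem extend_remove (c : C) (s : Prop) (V : Preference {x // x ≠ c}) :
    (V.extend c s).remove c = V := by
  ext x y
  simp [remove, comap, extend, x.2, y.2]

theorem isTop_extend {c : C} {s : Prop} (hs : s) (V : Preference {x // x ≠ c}) :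
    (V.extend c s).IsTop c := fun _ hx => Or.inl ⟨rfl, hx, hs⟩

theorem isBot_extend {c : C} {s : Prop} (hs : ¬ s) (V : Preference {x // x ≠ c}) :
    (V.extend c s).IsBot c := fun _ hx => Or.inr (Or.inl ⟨rfl, hx, hs⟩)

theorem isTop_or_isBot_extend (c : C) (s : Prop) (V : Preference {x // x ≠ c}) :
    (V.extend c s).IsTop c ∨ (V.extend c s).IsBot c :=
  (em s).imp (fun h => isTop_extend h V) fun h => isBot_extend h V

theorem isTop_extend_iff [Nontrivial C] (c : C) (s : Prop) (V : Preference {x // x ≠ c}) :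
    (V.extend c s).IsTop c ↔ s :=
  ⟨fun h => by_contra fun hs => h.not_isBot (isBot_extend hs V), fun h => isTop_extend h V⟩

theorem IsTop.remove {V : Preference C} {b c : C} (hb : V.IsTop b) (hbc : b ≠ c) :
    (V.remove c).IsTop ⟨b, hbc⟩ := fun x hx => hb x (by simpa [Subtype.ext_iff] using hx)

theorem IsBot.remove {V : Preference C} {b c : C} (hb : V.IsBot b) (hbc : b ≠ c) :
    (V.remove c).IsBot ⟨b, hbc⟩ := fun x hx => hb x (by simpa [Subtype.ext_iff] using hx)

theorem ext_of_remove {V W : Preference C} {c : C} (h : V.remove c = W.remove c)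
    (hV : V.IsTop c ∨ V.IsBot c) (hW : W.IsTop c ∨ W.IsBot c) (hVW : V.IsTop c ↔ W.IsTop c) :
    V = W := by
  ext x y
  have hne : ∀ x y, x ≠ c → y ≠ c → (V.above x y ↔ W.above x y) := fun x y hx hy =>
    iff_of_eq (congrFun (congrFun (congrArg Preference.above h) ⟨x, hx⟩) ⟨y, hy⟩)
  have key : (V.IsTop c ∧ W.IsTop c) ∨ (V.IsBot c ∧ W.IsBot c) := by tauto
  by_cases hx : x = c
  · subst hx
    by_cases hy : y = x
    · subst hy
      exact iff_of_false (V.irrefl _) (W.irrefl _)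
    · rcases key with ⟨h₁, h₂⟩ | ⟨h₁, h₂⟩
      · exact iff_of_true (h₁ y hy) (h₂ y hy)
      · exact iff_of_false (V.asymm (h₁ y hy)) (W.asymm (h₂ y hy))
  · by_cases hy : y = c
    · subst hy
      rcases key with ⟨h₁, h₂⟩ | ⟨h₁, h₂⟩
      · exact iff_of_false (V.asymm (h₁ x hx)) (W.asymm (h₂ x hx))
      · exact iff_of_true (h₁ x hx) (h₂ x hx)
    · exact hne x y hx hy

/-! ### Counting preferences -/

/-- The natural preference on `Fin m`, with `0` ranked first. -/
def natural (m : ℕ) : Preference (Fin m) where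
  above := (· < ·)
  strictTotal := inferInstance

theorem exists_equiv_fin [Finite C] {m : ℕ} (hC : Nat.card C = m) (V : Preference C) :
    ∃ e : C ≃ Fin m, ∀ x y, e x < e y ↔ V.above x y := by
  classical
  have := V.strictTotal
  have := Fintype.ofFinite C
  let L : LinearOrder C := linearOrderOfSTO V.above
  let e := Fintype.orderIsoFinOfCardEq C (Nat.card_eq_fintype_card.symm.trans hC)
  exact ⟨e.symm.toEquiv, fun x y => e.symm.lt_iff_lt⟩

theorem natCard_fin (m : ℕ) : Nat.card (Preference (Fin m)) = m.factorial := by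
  rw [show m.factorial = Nat.card (Equiv.Perm (Fin m)) by rw [Nat.card_perm, Nat.card_fin]]
  symm
  refine Nat.card_eq_of_bijective
    (fun σ : Equiv.Perm (Fin m) => (natural m).comap σ σ.injective) ⟨fun σ τ h => ?_, fun V => ?_⟩
  · have h' : ∀ x y, σ x < σ y ↔ τ x < τ y := fun x y =>
      iff_of_eq (congrFun (congrFun (congrArg Preference.above h) x) y)
    have hmono : StrictMono (σ.symm.trans τ) := fun x y hxy => by
      simpa [← h'] using hxy
    -- The only order automorphism of `Fin m` is the identity.
    have := Subsingleton.elim (hmono.orderIsoOfSurjective _ (σ.symm.trans τ).surjective)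
      (OrderIso.refl (Fin m))
    ext x
    have hx := congrArg (fun e : Fin m ≃o Fin m => e (σ x)) this
    simpa using congrArg Fin.val hx.symm
  · obtain ⟨e, he⟩ := V.exists_equiv_fin (Nat.card_fin m)
    exact ⟨e, Preference.ext (funext fun x => funext fun y => propext (he x y))⟩

end Preference

namespace Election

open Preference

/-! ### Removing and inserting extremal candidates in elections -/

variable {C D S : Type*} {n l : ℕ}

/-- The election pulled back along an injection of candidates. -/
def comap (P : Election C n) (f : D → C) (hf : Function.Injective f) : Election D n :=
  fun j => (P j).comap f hf

/-- The election with the candidate `c` removed. -/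
def remove (P : Election C n) (c : C) : Election {x // x ≠ c} n := fun j => (P j).remove c

/-- Every elector ranks the candidate `c` first or last. -/
def Extremal (P : Election C n) (c : C) : Prop := ∀ j, (P j).IsTop c ∨ (P j).IsBot c

theorem GroupSeparable.comap {P : Election C n} (hP : P.GroupSeparable) (f : D → C)
    (hf : Function.Injective f) : (P.comap f hf).GroupSeparable := by
  intro C' hC'
  obtain ⟨A, B, ⟨a, ha⟩, ⟨b, hb⟩, hd, hu, h⟩ := hP (f '' C') (hC'.image hf)
  have ha' : a ∈ f '' C' := hu ▸ Or.inl ha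
  have hb' : b ∈ f '' C' := hu ▸ Or.inr hb
  obtain ⟨a, -, rfl⟩ := ha'
  obtain ⟨b, -, rfl⟩ := hb'
  refine ⟨f ⁻¹' A, f ⁻¹' B, ⟨a, ha⟩, ⟨b, hb⟩, hd.preimage f, ?_, fun j => ?_⟩
  · rw [← Set.preimage_union, hu, Set.preimage_image_eq _ hf]
  · exact (h j).imp (fun h x hx y hy => h _ hx _ hy) fun h x hx y hy => h _ hx _ hy

theorem Contains.of_comap {P : Election C n} {f : D → C} {hf : Function.Injective f}
    {T : Election S l} (h : (P.comap f hf).Contains T) : P.Contains T := by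
  obtain ⟨e, g, he, hg, h⟩ := h
  exact ⟨e, f ∘ g, he, hf.comp hg, h⟩

theorem EnrichedGroupSeparable.remove {P : Election C n} (hP : P.EnrichedGroupSeparable)
    (c : C) : (P.remove c).EnrichedGroupSeparable :=
  ⟨hP.1.comap _ Subtype.val_injective, fun h => hP.2.1 h.of_comap, fun h => hP.2.2 h.of_comap⟩

theorem Extremal.groupSeparable {P : Election C n} {c : C} (hc : P.Extremal c)
    (h : (P.remove c).GroupSeparable) : P.GroupSeparable := by
  intro C' hC'
  by_cases hcC : c ∈ C'
  · obtain ⟨d, hd, hdc⟩ := hC'.exists_ne c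
    refine ⟨{c}, C' \ {c}, ⟨c, rfl⟩, ⟨d, hd, hdc⟩, Set.disjoint_sdiff_right, ?_, fun j => ?_⟩
    · exact Set.union_sdiff_cancel (by simpa using hcC)
    · refine (hc j).imp ?_ ?_ <;>
      · rintro h _ rfl y hy
        exact h y hy.2
  · have hsub : ∀ x ∈ C', x ≠ c := fun x hx hxc => hcC (hxc ▸ hx)
    obtain ⟨x, hx, y, hy, hxy⟩ := hC'
    obtain ⟨A, B, hA, hB, hd, hu, h⟩ := h (Subtype.val ⁻¹' C')
      ⟨⟨x, hsub x hx⟩, hx, ⟨y, hsub y hy⟩, hy, by simpa using hxy⟩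
    refine ⟨Subtype.val '' A, Subtype.val '' B, hA.image _, hB.image _,
      (Set.disjoint_image_iff Subtype.val_injective).2 hd, ?_, fun j => ?_⟩
    · rw [← Set.image_union, hu]
      exact Set.image_preimage_eq_of_subset fun x hx => ⟨⟨x, hsub x hx⟩, rfl⟩
    · refine (h j).imp ?_ ?_ <;>
      · rintro h _ ⟨x, hx, rfl⟩ _ ⟨y, hy, rfl⟩
        exact h x hx y hy

/-- A copy of `T` using `c` would make the preimage of `c` extremal in `T`, because the embedding
preserves orders; so the copy survives the removal of `c`. -/
theorem Extremal.contains_remove {P : Election C n} {c : C} (hc : P.Extremal c)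
    {T : Election S l} (hT : ∀ s, ¬ T.Extremal s) (h : P.Contains T) :
    (P.remove c).Contains T := by
  obtain ⟨f, g, hf, hg, h⟩ := h
  have hgc : ∀ s, g s ≠ c := by
    rintro s rfl
    refine hT s fun i => (hc (f i)).imp (fun H x hx => ?_) fun H x hx => ?_
    · by_contra hx'
      exact (P (f i)).asymm (H (g x) (hg.ne hx)) (h i x s (((T i).not_above hx.symm).1 hx'))
    · by_contra hx'
      exact (P (f i)).asymm (H (g x) (hg.ne hx)) (h i s x (((T i).not_above hx).1 hx'))
  exact ⟨f, fun s => ⟨g s, hgc s⟩, hf, fun x y hxy => hg (congrArg Subtype.val hxy), h⟩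

theorem not_extremal_configABCD_BADC (s : Fin 4) : ¬ configABCD_BADC.Extremal s := by
  intro h
  have h0 : (∀ x, x ≠ s → [0, 1, 2, 3].idxOf s < [0, 1, 2, 3].idxOf x) ∨
      (∀ x, x ≠ s → [0, 1, 2, 3].idxOf x < [0, 1, 2, 3].idxOf s) := h 0
  have h1 : (∀ x, x ≠ s → [1, 0, 3, 2].idxOf s < [1, 0, 3, 2].idxOf x) ∨
      (∀ x, x ≠ s → [1, 0, 3, 2].idxOf x < [1, 0, 3, 2].idxOf s) := h 1
  clear h
  revert s
  decide

theorem not_extremal_configACBD_BDAC (s : Fin 4) : ¬ configACBD_BDAC.Extremal s := by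
  intro h
  have h0 : (∀ x, x ≠ s → [0, 2, 1, 3].idxOf s < [0, 2, 1, 3].idxOf x) ∨
      (∀ x, x ≠ s → [0, 2, 1, 3].idxOf x < [0, 2, 1, 3].idxOf s) := h 0
  have h1 : (∀ x, x ≠ s → [1, 3, 0, 2].idxOf s < [1, 3, 0, 2].idxOf x) ∨
      (∀ x, x ≠ s → [1, 3, 0, 2].idxOf x < [1, 3, 0, 2].idxOf s) := h 1
  clear h
  revert s
  decide

theorem Extremal.enrichedGroupSeparable {P : Election C n} {c : C} (hc : P.Extremal c)
    (h : (P.remove c).EnrichedGroupSeparable) : P.EnrichedGroupSeparable :=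
  ⟨hc.groupSeparable h.1,
    fun h' => h.2.1 (hc.contains_remove not_extremal_configABCD_BADC h'),
    fun h' => h.2.2 (hc.contains_remove not_extremal_configACBD_BDAC h')⟩

/-! ### Forbidden configurations force an extremal candidate -/

theorem contains_configABCD_BADC {P : Election C n} {p q : Fin n} (hpq : p ≠ q) {a b c d : C}
    (hab : (P p).above a b) (hbc : (P p).above b c) (hcd : (P p).above c d)
    (hba : (P q).above b a) (had : (P q).above a d) (hdc : (P q).above d c) :
    P.Contains configABCD_BADC := by
  have hac := (P p).trans hab hbc
  have hbd := (P p).trans hbc hcd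
  have had' := (P p).trans hac hcd
  have hbd' := (P q).trans hba had
  have hac' := (P q).trans had hdc
  have hbc' := (P q).trans hba hac'
  have := (P p).ne hab
  have := (P p).ne hac
  have := (P p).ne had'
  have := (P p).ne hbc
  have := (P p).ne hbd
  have := (P p).ne hcd
  refine ⟨![p, q], ![a, b, c, d], ?_, ?_, ?_⟩
  · intro x y
    fin_cases x <;> fin_cases y <;> simp [hpq, hpq.symm]
  · intro x y
    fin_cases x <;> fin_cases y <;> simp [*, Ne.symm, eq_comm]
  · intro i x y
    fin_cases i <;> fin_cases x <;> fin_cases y <;>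
      simp [configABCD_BADC, ofList, List.idxOf_cons, *]

theorem contains_configACBD_BDAC {P : Election C n} {p q : Fin n} (hpq : p ≠ q) {a b c d : C}
    (hac : (P p).above a c) (hcb : (P p).above c b) (hbd : (P p).above b d)
    (hbd' : (P q).above b d) (hda : (P q).above d a) (hac' : (P q).above a c) :
    P.Contains configACBD_BDAC := by
  have hab := (P p).trans hac hcb
  have hcd := (P p).trans hcb hbd
  have had := (P p).trans hab hbd
  have hba := (P q).trans hbd' hda
  have hdc := (P q).trans hda hac'
  have hbc := (P q).trans hba hac'
  have := (P p).ne hab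
  have := (P p).ne hac
  have := (P p).ne had
  have := (P p).ne hcb
  have := ((P p).ne hcb).symm
  have := (P p).ne hbd
  have := (P p).ne hcd
  refine ⟨![p, q], ![a, b, c, d], ?_, ?_, ?_⟩
  · intro x y
    fin_cases x <;> fin_cases y <;> simp [hpq, hpq.symm]
  · intro x y
    fin_cases x <;> fin_cases y <;> simp [*, Ne.symm, eq_comm]
  · intro i x y
    fin_cases i <;> fin_cases x <;> fin_cases y <;>
      simp [configACBD_BDAC, ofList, List.idxOf_cons, *]

/-- Two electors who agree on two blocks of candidates do not disagree inside both blocks, and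
two electors who disagree on two blocks do not agree on pairs inside both blocks. -/
theorem EnrichedGroupSeparable.not_of_blocks {P : Election C n} (hP : P.EnrichedGroupSeparable)
    {A B : Set C} (hAB : ∀ j, (∀ x ∈ A, ∀ y ∈ B, (P j).above x y) ∨
      (∀ x ∈ A, ∀ y ∈ B, (P j).above y x)) {p q : Fin n}
    {x y z w : C} (hx : x ∈ A) (hy : y ∈ A) (hz : z ∈ B) (hw : w ∈ B) (hxy : x ≠ y) (hzw : z ≠ w)
    (h₁ : ((P p).above x z ↔ (P q).above x z) ↔ ¬ ((P p).above x y ↔ (P q).above x y))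
    (h₂ : ((P p).above x z ↔ (P q).above x z) ↔ ¬ ((P p).above z w ↔ (P q).above z w)) :
    False := by
  have hpq : p ≠ q := by
    rintro rfl
    exact h₁.1 Iff.rfl Iff.rfl
  -- The hypotheses are symmetric in the two members of each pair, so each pair can be named in the
  -- order of `p`.
  have wlog_zw : ∃ z' ∈ B, ∃ w' ∈ B, (P p).above z' w' ∧
      (((P p).above x z ↔ (P q).above x z) ↔ (P q).above w' z') := by
    by_cases h : (P p).above z w
    · exact ⟨z, hz, w, hw, h,
        h₂.trans (by rw [iff_true_left h, (P q).not_above hzw])⟩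
    · exact ⟨w, hw, z, hz, ((P p).not_above hzw).1 h,
        h₂.trans (by rw [iff_false_left h, not_not])⟩
  have wlog_xy : ∃ x' ∈ A, ∃ y' ∈ A, (P p).above x' y' ∧
      (((P p).above x z ↔ (P q).above x z) ↔ (P q).above y' x') := by
    by_cases h : (P p).above x y
    · exact ⟨x, hx, y, hy, h,
        h₁.trans (by rw [iff_true_left h, (P q).not_above hxy])⟩
    · exact ⟨y, hy, x, hx, ((P p).not_above hxy).1 h,
        h₁.trans (by rw [iff_false_left h, not_not])⟩
  obtain ⟨c, hc, d, hd, hcd, hcd'⟩ := wlog_zw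
  obtain ⟨a, ha, b, hb, hab, hab'⟩ := wlog_xy
  have nab := (P q).not_above ((P p).ne hab).symm
  have ncd := (P q).not_above ((P p).ne hcd).symm
  rcases hAB p with hp | hp <;> rcases hAB q with hq | hq
  · have e := iff_of_true (hp x hx z hz) (hq x hx z hz)
    exact hP.2.1 (contains_configABCD_BADC hpq hab (hp b hb c hc) hcd (hab'.1 e)
      (hq a ha d hd) (hcd'.1 e))
  · have e : ¬ ((P p).above x z ↔ (P q).above x z) := fun e =>
      (P q).asymm (hq x hx z hz) (e.1 (hp x hx z hz))
    exact hP.2.2 (contains_configACBD_BDAC hpq hab (hp b hb c hc) hcd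
      (ncd.1 (mt hcd'.2 e)) (hq a ha d hd) (nab.1 (mt hab'.2 e)))
  · have e : ¬ ((P p).above x z ↔ (P q).above x z) := fun e =>
      (P p).asymm (hp x hx z hz) (e.2 (hq x hx z hz))
    exact hP.2.2 (contains_configACBD_BDAC hpq hcd (hp a ha d hd) hab
      (nab.1 (mt hab'.2 e)) (hq b hb c hc) (ncd.1 (mt hcd'.2 e)))
  · have e := iff_of_false ((P p).asymm (hp x hx z hz)) ((P q).asymm (hq x hx z hz))
    exact hP.2.1 (contains_configABCD_BADC hpq hcd (hp a ha d hd) hab (hcd'.1 e)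
      (hq b hb c hc) (hab'.1 e))

/-- Split all candidates into A above B for elector i, so t ∈ A and b ∈ B. If neither is extremal,
some y ∈ A and z ∈ B witness it. Give each elector two bits: whether its order of t, y, respectively
of z, b, matches its order of the blocks. By `not_of_blocks` no two electors differ in both bits.
But i has both bits true, some j fails the first and some k the second, which is impossible. -/
theorem EnrichedGroupSeparable.extremal_or_extremal [Nontrivial C] {P : Election C n}
    (hP : P.EnrichedGroupSeparable) {i : Fin n} {t b : C} (ht : (P i).IsTop t)
    (hb : (P i).IsBot b) : P.Extremal t ∨ P.Extremal b := by
  have key : ∀ A B : Set C, A.Nonempty → B.Nonempty → A ∪ B = Set.univ →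
      (∀ j, (∀ x ∈ A, ∀ y ∈ B, (P j).above x y) ∨ (∀ x ∈ A, ∀ y ∈ B, (P j).above y x)) →
      (∀ x ∈ A, ∀ y ∈ B, (P i).above x y) → P.Extremal t ∨ P.Extremal b := by
    rintro A B ⟨a, ha⟩ ⟨c, hc⟩ hu hAB hi
    have hmem : ∀ x, x ∈ A ∨ x ∈ B := fun x => (hu ▸ Set.mem_univ x : x ∈ A ∪ B)
    have htA : t ∈ A := (hmem t).resolve_right fun h =>
      (P i).asymm (hi a ha t h) (ht a ((P i).ne (hi a ha t h)))
    have hbB : b ∈ B := (hmem b).resolve_left fun h =>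
      (P i).asymm (hi b h c hc) (hb c ((P i).ne (hi b h c hc)).symm)
    have hcross : ∀ j, ∀ x ∈ A, ∀ y ∈ B, ((P j).above x y ↔ (P j).above t b) := by
      intro j x hx y hy
      rcases hAB j with h | h
      · exact iff_of_true (h x hx y hy) (h t htA b hbB)
      · exact iff_of_false ((P j).asymm (h x hx y hy)) ((P j).asymm (h t htA b hbB))
    by_contra hcon
    rw [not_or] at hcon
    obtain ⟨hnt, hnb⟩ := hcon
    -- Comparisons across the blocks always match the block order, so the failure of t to be
    -- extremal must occur inside A.
    have hA : ∃ y ∈ A, y ≠ t ∧ ∃ j, ¬ ((P j).above t y ↔ (P j).above t b) := by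
      by_contra! hcon
      refine hnt fun j => ?_
      have hall : ∀ y, y ≠ t → ((P j).above t y ↔ (P j).above t b) := fun y hy =>
        (hmem y).elim (fun h => hcon y h hy j) fun h => hcross j t htA y h
      by_cases h : (P j).above t b
      · exact Or.inl fun y hy => (hall y hy).2 h
      · exact Or.inr fun y hy => ((P j).not_above hy.symm).1 fun h' => h ((hall y hy).1 h')
    have hB : ∃ z ∈ B, z ≠ b ∧ ∃ k, ¬ ((P k).above z b ↔ (P k).above t b) := by
      by_contra! hcon
      refine hnb fun j => ?_
      have hall : ∀ y, y ≠ b → ((P j).above y b ↔ (P j).above t b) := fun y hy =>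
        (hmem y).elim (fun h => hcross j y h b hbB) fun h => hcon y h hy j
      by_cases h : (P j).above t b
      · exact Or.inr fun y hy => (hall y hy).2 h
      · exact Or.inl fun y hy => ((P j).not_above hy).1 fun h' => h ((hall y hy).1 h')
    obtain ⟨y, hy, hyt, j, hj⟩ := hA
    obtain ⟨z, hz, hzb, k, hk⟩ := hB
    have hi₁ := ht y hyt
    have hi₂ := hb z hzb
    have hi₃ := hi t htA b hbB
    have main : ∀ p q, (((P p).above t b ↔ (P q).above t b) ↔
        ¬ ((P p).above t y ↔ (P q).above t y)) → (((P p).above t b ↔ (P q).above t b) ↔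
        ¬ ((P p).above z b ↔ (P q).above z b)) → False := fun p q h₁ h₂ =>
      hP.not_of_blocks hAB htA hy hz hbB hyt.symm hzb
        ((iff_congr (hcross p t htA z hz) (hcross q t htA z hz)).trans h₁)
        ((iff_congr (hcross p t htA z hz) (hcross q t htA z hz)).trans h₂)
    -- Comparison with i forces k to keep its first bit and j its second; then j and k differ in
    -- both.
    have hik := main i k
    have hij := main i j
    have hjk := main j k
    rw [iff_true_left hi₁, iff_true_left hi₂, iff_true_left hi₃] at hik hij
    have hyk : (P k).above t y ↔ (P k).above t b :=
      by_contra fun h => hik (not_iff.1 h).symm (not_iff.1 hk).symm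
    have hzj : (P j).above z b ↔ (P j).above t b :=
      by_contra fun h => hij (not_iff.1 hj).symm (not_iff.1 h).symm
    rw [hyk, hzj] at hjk
    clear * - hj hk hjk
    exact hjk (by tauto) (by tauto)
  obtain ⟨A, B, hA, hB, -, hu, hAB⟩ := hP.1 Set.univ Set.nontrivial_univ
  rcases hAB i with h | h
  · exact key A B hA hB hu hAB h
  · exact key B A hB hA (by rw [Set.union_comm, hu])
      (fun j => (hAB j).symm.imp (fun h x hx y hy => h y hy x hx) fun h x hx y hy => h y hy x hx)
      fun x hx y hy => h y hy x hx

/-! ### The recurrence for a fixed ballot -/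

/-- The enriched group-separable elections in which the preference of elector `i` is `V`. -/
def enrichedFixed (i : Fin n) (V : Preference C) : Set (Election C n) :=
  {P | P.EnrichedGroupSeparable ∧ P i = V}

theorem EnrichedGroupSeparable.of_subsingleton [Subsingleton C] (P : Election C n) :
    P.EnrichedGroupSeparable := by
  have hno : ∀ T : Election (Fin 4) 2, ¬ P.Contains T := by
    rintro T ⟨f, g, hf, hg, -⟩
    exact absurd (hg (Subsingleton.elim (g 0) (g 1))) (by decide)
  exact ⟨fun C' hC' => absurd Set.subsingleton_of_subsingleton hC'.not_subsingleton,
    hno _, hno _⟩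

theorem ncard_enrichedFixed_of_subsingleton [Subsingleton C] (i : Fin n) (V : Preference C) :
    (enrichedFixed i V).ncard = 1 :=
  Set.ncard_eq_one.2 ⟨fun _ => V, Set.eq_singleton_iff_unique_mem.2
    ⟨⟨.of_subsingleton _, rfl⟩, fun _ _ => Subsingleton.elim _ _⟩⟩

/-- An election with `c` extremal is the same as its restriction together with the side of `c` for
each elector other than `i`; the side for `i` is dictated by `V`. Nontriviality makes the two sides
distinct. -/
theorem ncard_enrichedFixed_extremal [Nontrivial C] {i : Fin n} {V : Preference C} {c : C}
    (hc : V.IsTop c ∨ V.IsBot c) :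
    {P ∈ enrichedFixed i V | P.Extremal c}.ncard =
      2 ^ (n - 1) * (enrichedFixed i (V.remove c)).ncard := by
  have hcard : Nat.card ({j : Fin n // j ≠ i} → Prop) = 2 ^ (n - 1) := by
    simp
  rw [← hcard, ← Nat.card_coe_set_eq (enrichedFixed i (V.remove c)), ← Nat.card_prod,
    ← Nat.card_coe_set_eq]
  refine Nat.card_eq_of_bijective (fun P => (fun j => (P.1 j.1).IsTop c,
    ⟨P.1.remove c, P.2.1.1.remove c, by rw [Election.remove, P.2.1.2]⟩)) ⟨?_, ?_⟩
  · rintro ⟨P, ⟨hP, hPi⟩, hPc⟩ ⟨Q, ⟨hQ, hQi⟩, hQc⟩ h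
    have h₁ := congrArg Prod.fst h
    have h₂ : P.remove c = Q.remove c := congrArg (fun x => x.2.1) h
    rw [Subtype.mk.injEq]
    funext j
    by_cases hj : j = i
    · rw [hj, hPi, hQi]
    · exact ext_of_remove (congrFun h₂ j) (hPc j) (hQc j) (iff_of_eq (congrFun h₁ ⟨j, hj⟩))
  · rintro ⟨s, P, hP, hPi⟩
    let s' : Fin n → Prop := fun j => if hj : j = i then V.IsTop c else s ⟨j, hj⟩
    let Q : Election C n := fun j => (P j).extend c (s' j)
    have hQP : Q.remove c = P := funext fun j => extend_remove _ _ _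
    have hQc : Q.Extremal c := fun j => isTop_or_isBot_extend _ _ _
    have hQt : ∀ j, (Q j).IsTop c ↔ s' j := fun j => isTop_extend_iff _ _ _
    have hQi : Q i = V := ext_of_remove ((congrFun hQP i).trans hPi) (hQc i) hc
      (by rw [hQt]; simp [s'])
    refine ⟨⟨Q, ⟨hQc.enrichedGroupSeparable (hQP ▸ hP), hQi⟩, hQc⟩, ?_⟩
    refine Prod.ext (funext fun j => ?_) (Subtype.ext hQP)
    exact propext ((hQt j).trans (by simp [s', j.2]))

/-- When both are extremal, `t` is first exactly where `b` is last, so removing `t` loses no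
information. With only two candidates this fails: after the removal `b` would be both first and
last. -/
theorem ncard_enrichedFixed_extremal_extremal {i : Fin n} {V : Preference C} {t b : C}
    (ht : V.IsTop t) (hb : V.IsBot b) (hbt : b ≠ t) [Nontrivial {x // x ≠ t}] :
    {P ∈ enrichedFixed i V | P.Extremal t ∧ P.Extremal b}.ncard =
      {P ∈ enrichedFixed i (V.remove t) | P.Extremal ⟨b, hbt⟩}.ncard := by
  rw [← Nat.card_coe_set_eq, ← Nat.card_coe_set_eq]
  refine Nat.card_eq_of_bijective (fun P => ⟨P.1.remove t,
    ⟨P.2.1.1.remove t, by rw [Election.remove, P.2.1.2]⟩,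
    fun j => (P.2.2.2 j).imp (fun h => h.remove hbt) fun h => h.remove hbt⟩) ⟨?_, ?_⟩
  · rintro ⟨P, ⟨hP, hPi⟩, hPt, hPb⟩ ⟨Q, ⟨hQ, hQi⟩, hQt, hQb⟩ h
    simp only [Subtype.mk.injEq] at h
    rw [Subtype.mk.injEq]
    funext j
    have hiff : ∀ R : Election C n, R.Extremal t → R.Extremal b →
        ((R j).IsTop t ↔ (R.remove t j).IsBot ⟨b, hbt⟩) := by
      refine fun R hRt hRb => ⟨fun h => ?_, fun h => ?_⟩
      · rcases hRb j with h' | h'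
        · exact absurd (h' t hbt.symm) ((R j).asymm (h b hbt))
        · exact h'.remove hbt
      · rcases hRb j with h' | h'
        · exact absurd h (h'.remove hbt).not_isBot
        · exact (hRt j).resolve_right fun h'' => (R j).asymm (h'' b hbt) (h' t hbt.symm)
    exact ext_of_remove (congrFun h j) (hPt j) (hQt j)
      (by rw [hiff P hPt hPb, hiff Q hQt hQb, h])
  · rintro ⟨P, ⟨hP, hPi⟩, hPb⟩
    let Q : Election C n := fun j => (P j).extend t ((P j).IsBot ⟨b, hbt⟩)
    have hQP : Q.remove t = P := funext fun j => extend_remove _ _ _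
    have hQt : Q.Extremal t := fun j => isTop_or_isBot_extend _ _ _
    have hQi : Q i = V := ext_of_remove ((congrFun hQP i).trans hPi) (hQt i) (Or.inl ht)
      (iff_of_true (isTop_extend (by rw [hPi]; exact hb.remove hbt) _) ht)
    have hQb : Q.Extremal b := by
      intro j
      by_cases h : (P j).IsBot ⟨b, hbt⟩
      · refine Or.inr fun x hx => ?_
        by_cases hxt : x = t
        · exact Or.inl ⟨hxt, hbt, h⟩
        · exact Or.inr (Or.inr ⟨hxt, hbt, h ⟨x, hxt⟩ (by simpa using hx)⟩)
      · refine Or.inl fun x hx => ?_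
        by_cases hxt : x = t
        · exact Or.inr (Or.inl ⟨hxt, hbt, h⟩)
        · exact Or.inr (Or.inr ⟨hbt, hxt,
            (hPb j).resolve_right h ⟨x, hxt⟩ (by simpa using hx)⟩)
    exact ⟨⟨Q, ⟨hQt.enrichedGroupSeparable (hQP ▸ hP), hQi⟩, hQt, hQb⟩, Subtype.ext hQP⟩

/-- The induction ranges over all candidate types of a given size, since removal passes to a
subtype. -/
theorem ncard_enrichedFixed (n : ℕ) (i : Fin n) (F : ℕ → ℝ) (h0 : F 0 = 1) (h1 : F 1 = 1)
    (hF : ∀ m, F (m + 2) = 2 * 2 ^ (n - 1) * F (m + 1) - 2 ^ (n - 1) * F m) (m : ℕ) :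
    ∀ (C : Type) [Finite C], Nat.card C = m → ∀ V : Preference C,
      ((enrichedFixed i V).ncard : ℝ) = F m := by
  induction m using Nat.strong_induction_on with
  | _ m ih =>
  intro C _ hC V
  match m, ih, hC with
  | 0, _, hC =>
    have := Finite.card_le_one_iff_subsingleton.1 (hC.trans_le zero_le_one)
    simp [ncard_enrichedFixed_of_subsingleton, h0]
  | 1, _, hC =>
    have := Finite.card_le_one_iff_subsingleton.1 hC.le
    simp [ncard_enrichedFixed_of_subsingleton, h1]
  | m + 2, ih, hC =>
    have : Nontrivial C := Finite.one_lt_card_iff_nontrivial.1 (by omega)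
    obtain ⟨t, ht⟩ := V.exists_isTop
    obtain ⟨b, hb⟩ := V.exists_isBot
    have hbt : b ≠ t := by
      rintro rfl
      exact ht.not_isBot hb
    have hremove : ∀ (C : Type) [Finite C] (c : C), Nat.card {x // x ≠ c} = Nat.card C - 1 := by
      intro C _ c
      classical
      have := Fintype.ofFinite C
      simp [Nat.card_eq_fintype_card]
    have hX := ncard_enrichedFixed_extremal (i := i) (Or.inl ht : V.IsTop t ∨ V.IsBot t)
    have hY := ncard_enrichedFixed_extremal (i := i) (Or.inr hb : V.IsTop b ∨ V.IsBot b)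
    have hunion : {P ∈ enrichedFixed i V | P.Extremal t} ∪ {P ∈ enrichedFixed i V | P.Extremal b} =
        enrichedFixed i V := by
      rw [← Set.sep_or]
      refine Set.sep_eq_self_iff_mem_true.2 fun P hP => ?_
      exact hP.1.extremal_or_extremal (i := i) (hP.2 ▸ ht) (hP.2 ▸ hb)
    have hinter : ({P ∈ enrichedFixed i V | P.Extremal t} ∩
        {P ∈ enrichedFixed i V | P.Extremal b}).ncard = (2 : ℝ) ^ (n - 1) * F m := by
      rw [← Set.sep_and]
      -- With two candidates, `t` is extremal exactly when `b` is, so the intersection has N·F(1)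
      -- elements; this is N·F(0) because F(0) = F(1).
      match m, ih, hC with
      | 0, ih, hC =>
        have hall : ∀ x, x = t ∨ x = b := by
          intro x
          by_contra! h
          have := Finite.card_le_one_iff_subsingleton.1
            ((hremove C t).trans_le (by omega))
          exact h.2 (congrArg Subtype.val
            (Subsingleton.elim (⟨x, h.1⟩ : {x // x ≠ t}) ⟨b, hbt⟩))
        have himp : ∀ P : Election C n, P.Extremal t → P.Extremal b := by
          refine fun P h j => (h j).symm.imp (fun h x hx => ?_) fun h x hx => ?_
          · rw [(hall x).resolve_right hx]
            exact h b hbt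
          · rw [(hall x).resolve_right hx]
            exact h b hbt
        rw [show {P ∈ enrichedFixed i V | P.Extremal t ∧ P.Extremal b} =
          {P ∈ enrichedFixed i V | P.Extremal t} from
            Set.ext fun P => and_congr_right fun _ => and_iff_left_of_imp (himp P), hX]
        push_cast
        rw [ih 1 (by omega) _ (by rw [hremove, hC]), h0, h1]
      | m + 1, ih, hC =>
        have : Nontrivial {x // x ≠ t} :=
          Finite.one_lt_card_iff_nontrivial.1 (by rw [hremove]; omega)
        rw [ncard_enrichedFixed_extremal_extremal ht hb hbt,
          ncard_enrichedFixed_extremal (Or.inr (hb.remove hbt))]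
        push_cast
        rw [ih (m + 1) (by omega) _ (by rw [hremove, hremove, hC]; rfl)]
    have hsum := Set.ncard_union_add_ncard_inter {P ∈ enrichedFixed i V | P.Extremal t}
      {P ∈ enrichedFixed i V | P.Extremal b}
    rw [hunion, hX, hY] at hsum
    have hsum' := congrArg (Nat.cast : ℕ → ℝ) hsum
    push_cast at hsum'
    rw [hinter, ih (m + 1) (by omega) {x // x ≠ t} (by rw [hremove, hC]; rfl),
      ih (m + 1) (by omega) {x // x ≠ b} (by rw [hremove, hC]; rfl)] at hsum'
    rw [hF]
    linarith

theorem numEnriched_eq_sum (m n : ℕ) (i : Fin n) [Fintype (Preference (Fin m))] :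
    numEnriched m n = ∑ V : Preference (Fin m), numEnrichedFixed m n i V := by
  simp only [numEnrichedFixed]
  rw [← Nat.card_sigma]
  refine Nat.card_congr
    { toFun := fun P => ⟨P.1 i, P.1, P.2, rfl⟩
      invFun := fun P => ⟨P.2.1, P.2.2.1⟩
      left_inv := fun _ => rfl
      right_inv := ?_ }
  rintro ⟨_, P, hP, rfl⟩
  rfl

end Election

theorem mainTheorem4 (m n : ℕ) (hn : 2 ≤ n) (φ : ℝ)
    (hφ : φ = Real.sqrt ((2 : ℝ) ^ (n - 1) * ((2 : ℝ) ^ (n - 1) - 1))) :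
    (∀ (i : Fin n) (V : Preference (Fin m)),
      (Election.numEnrichedFixed m n i V : ℝ) =
        (φ + (1 - (2 : ℝ) ^ (n - 1))) / (2 * φ) * ((2 : ℝ) ^ (n - 1) + φ) ^ m +
          (φ - (1 - (2 : ℝ) ^ (n - 1))) / (2 * φ) * ((2 : ℝ) ^ (n - 1) - φ) ^ m) ∧
    (Election.numEnriched m n : ℝ) =
      (Nat.factorial m : ℝ) *
        ((φ + (1 - (2 : ℝ) ^ (n - 1))) / (2 * φ) * ((2 : ℝ) ^ (n - 1) + φ) ^ m +
          (φ - (1 - (2 : ℝ) ^ (n - 1))) / (2 * φ) * ((2 : ℝ) ^ (n - 1) - φ) ^ m) := by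
  set N : ℝ := (2 : ℝ) ^ (n - 1) with hN
  set F : ℕ → ℝ := fun m => (φ + (1 - N)) / (2 * φ) * (N + φ) ^ m +
    (φ - (1 - N)) / (2 * φ) * (N - φ) ^ m with hFdef
  -- This is where n ≥ 2 matters: for n = 1, φ would vanish.
  have hN1 : 1 < N := one_lt_pow₀ one_lt_two (by omega)
  have hpos : 0 < N * (N - 1) := mul_pos (by linarith) (by linarith)
  have hφ0 : φ ≠ 0 := hφ ▸ (Real.sqrt_pos.2 hpos).ne'
  have hφ2 : φ ^ 2 = N * (N - 1) := hφ ▸ Real.sq_sqrt hpos.le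
  have h0 : F 0 = 1 := by
    simp only [hFdef]
    field_simp
    ring
  have h1 : F 1 = 1 := by
    simp only [hFdef]
    field_simp
    ring
  have hF : ∀ m, F (m + 2) = 2 * N * F (m + 1) - N * F m := by
    intro m
    -- N ± φ are the roots of the characteristic equation x² = 2Nx - N.
    have e₁ : (N + φ) ^ 2 = 2 * N * (N + φ) - N := by linear_combination hφ2
    have e₂ : (N - φ) ^ 2 = 2 * N * (N - φ) - N := by linear_combination hφ2
    simp only [hFdef, pow_add, e₁, e₂]
    ring
  have hfix : ∀ (i : Fin n) (V : Preference (Fin m)),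
      (Election.numEnrichedFixed m n i V : ℝ) = F m := fun i V =>
    Election.ncard_enrichedFixed n i F h0 h1 hF m (Fin m) (Nat.card_fin m) V
  refine ⟨hfix, ?_⟩
  have := Fintype.ofFinite (Preference (Fin m))
  rw [Election.numEnriched_eq_sum m n ⟨0, by omega⟩, Nat.cast_sum,
    Finset.sum_congr rfl fun V _ => hfix _ V, Finset.sum_const, Finset.card_univ,
    ← Nat.card_eq_fintype_card, Preference.natCard_fin, nsmul_eq_mul]
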